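/- Let $C$ be a chain (linearly ordered set) without a greatest element, of regular cardinality $\kappa>\aleph_0$, such that every interval (order-convex subset) of $C$ with at least two points has cardinality $\kappa$ and no subset of $C$ is order isomorphic to the ordinal $\kappa$ or to its inverse. Let $\mathbb{B}(C)$ be the interval algebra of $C$, that is, the subalgebra of the power set $\mathcal{P}(C)$ generated by the intervals $[a,\to)=\{x\in C: x\ge a\}$, $a\in C$, and let $\mathrm{Ult}(\mathbb{B}(C))$ be the space of ultrafilters of $\mathbb{B}(C)$ with the Stone topology, whose basic open sets are $\{p: a\in p\}$, $a\in\mathbb{B}(C)$. Then for every set $G\subseteq\mathbb{B}(C)$ that generates $\mathbb{B}(C)$ as a Boolean algebra, the set $$S=\{p\in\mathrm{Ult}(\mathbb{B}(C)) : |G\cap p|<\kappa\}$$ is nowhere dense in $\mathrm{Ult}(\mathbb{B}(C))$. -/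

import Mathlib

open Cardinal

/-- The interval algebra of a chain `C`: the subalgebra of the power set of `C` generated by the
intervals `[a, →)`, `a ∈ C`. -/
def intervalAlgebra (C : Type*) [LinearOrder C] : BooleanSubalgebra (Set C) :=
  BooleanSubalgebra.closure (Set.range (Set.Ici : C → Set C))

/-- Ultrafilters of a Boolean algebra: proper filters that contain `a` or `-a` for every `a`. -/
structure Ult (B : Type*) [BooleanAlgebra B] extends Order.PFilter B where
  bot_notMem : ⊥ ∉ toPFilter
  mem_or_compl_mem : ∀ a : B, a ∈ toPFilter ∨ aᶜ ∈ toPFilter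

namespace Ult

/-- The set of elements of an ultrafilter. -/
def elems {B : Type*} [BooleanAlgebra B] (p : Ult B) : Set B := {a | a ∈ p.toPFilter}

/-- The Stone topology, generated by the sets `{p | a ∈ p}`, `a ∈ B`. -/
instance {B : Type*} [BooleanAlgebra B] : TopologicalSpace (Ult B) :=
  TopologicalSpace.generateFrom (Set.range fun a : B => {p : Ult B | a ∈ p.elems})

end Ult

/-- `G` generates the Boolean algebra `B`. -/
def IsGenerating {B : Type*} [BooleanAlgebra B] (G : Set B) : Prop :=
  BooleanSubalgebra.closure G = ⊤

universe u

/-! If `S` is somewhere dense, it is dense in the open set given by some interval `[c, d)`. Each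
`[u, v)` with `c ≤ u < v ≤ d` then lies in an ultrafilter of `S`, which contains every generator
including `[u, v)`; so there are fewer than `κ` such generators.

Each generator depends on finitely many cut points. Since `κ` and its inverse do not embed, each
point is approached from either side by fewer than `κ` points. Closing `{c, d}` under these
approaching points and under the cut points of the generators above gives a set `A` with `#A < κ`
(`exists_small_closed`).

A point `x ∈ [c, d)` outside `A` would fill a gap of `A` with no last point of `A` below and no
first one above. Every generator is constant on `A` near this gap, hence so is every element of the
algebra; but `[x, →)` is not (`mem_of_generators_supported`). So `[c, d] ⊆ A`, although `[c, d]` has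
cardinality `κ`. -/

/-- If `κ.ord` does not embed into a linear order, then every initial segment `Iio c` has a cofinal
subset of cardinality less than `κ`. -/
theorem exists_small_cofinal_Iio {D : Type u} [LinearOrder D] (κ : Cardinal.{u})
    (hinc : ∀ A : Set D, IsEmpty (A ≃o κ.ord.ToType)) (c : D) :
    ∃ F : Set D, #F < κ ∧ (∀ y ∈ F, y < c) ∧ ∀ x < c, ∃ y ∈ F, x ≤ y := by
  by_contra! H
  have : Nonempty D := ⟨c⟩
  choose! b hbc hb using H
  -- Each value is a strict upper bound, still below `c`, of the earlier ones; this would embed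
  -- `κ.ord`.
  let f : κ.ord.ToType → D :=
    wellFounded_lt.fix fun i ih => b (Set.range fun j : Set.Iio i => ih j j.2)
  have hf (i : κ.ord.ToType) : f i = b (f '' Set.Iio i) := by
    rw [Set.image_eq_range]
    exact wellFounded_lt.fix_eq _ i
  have hcard (i : κ.ord.ToType) : #(f '' Set.Iio i) < κ :=
    mk_image_le.trans_lt (by simpa using mk_Iio_lt i (by simp))
  have hlt (i : κ.ord.ToType) : f i < c := by
    induction i using WellFoundedLT.induction with
    | ind i ih =>
      rw [hf]
      exact hbc _ (hcard i) (by rintro _ ⟨j, hj, rfl⟩; exact ih j hj)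
  have hmono : StrictMono f := fun j i hji => by
    rw [hf i]
    exact hb _ (hcard i) (by rintro _ ⟨k, -, rfl⟩; exact hlt k) _ ⟨j, hji, rfl⟩
  exact (hinc _).false (hmono.orderIso f).symm

/-- If the reverse of `κ.ord` does not embed into a linear order, then every final segment `Ioi c`
has a coinitial subset of cardinality less than `κ`. -/
theorem exists_small_coinitial_Ioi {D : Type u} [LinearOrder D] (κ : Cardinal.{u})
    (hdec : ∀ A : Set D, IsEmpty (A ≃o (κ.ord.ToType)ᵒᵈ)) (c : D) :
    ∃ F : Set D, #F < κ ∧ (∀ y ∈ F, c < y) ∧ ∀ x, c < x → ∃ y ∈ F, y ≤ x := by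
  refine exists_small_cofinal_Iio (D := Dᵒᵈ) κ (fun A => ⟨fun e => ?_⟩) (OrderDual.toDual c)
  refine (hdec (OrderDual.toDual ⁻¹' A)).false
    ⟨⟨fun x => OrderDual.toDual (e ⟨OrderDual.toDual x.1, x.2⟩),
      fun i => ⟨OrderDual.ofDual (e.symm (OrderDual.ofDual i)).1, (e.symm (OrderDual.ofDual i)).2⟩,
      fun x => ?_, fun i => ?_⟩, ?_⟩
  · simp
  · simp
  · intro x y
    simp only [Equiv.coe_fn_mk, OrderDual.toDual_le_toDual, e.le_iff_le]
    exact Iff.rfl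

/-- For `κ` regular and uncountable, every small set is contained in a small set closed under a
given binary operation with small sets as values. -/
theorem exists_small_closed {α : Type u} {κ : Cardinal.{u}} (hκ : κ.IsRegular) (hκ' : ℵ₀ < κ)
    (f : α → α → Set α) (hf : ∀ x y, #(f x y) < κ) (A₀ : Set α) (hA₀ : #A₀ < κ) :
    ∃ A : Set α, A₀ ⊆ A ∧ #A < κ ∧ ∀ x ∈ A, ∀ y ∈ A, f x y ⊆ A := by
  let step : Set α → Set α := fun A => A ∪ ⋃ x ∈ A, ⋃ y ∈ A, f x y
  let s : ℕ → Set α := fun n => step^[n] A₀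
  have hs (n : ℕ) : s (n + 1) = s n ∪ ⋃ x ∈ s n, ⋃ y ∈ s n, f x y :=
    Function.iterate_succ_apply' step n A₀
  have hmono : Monotone s := monotone_nat_of_le_succ fun n => by
    rw [hs]
    exact Set.subset_union_left
  have hcard (n : ℕ) : #(s n) < κ := by
    induction n with
    | zero => exact hA₀
    | succ n ih =>
      rw [hs]
      refine (mk_union_le _ _).trans_lt (add_lt_of_lt hκ.aleph0_le ih ?_)
      refine (card_biUnion_lt_iff_forall_of_isRegular hκ ih).2 fun x _ => ?_
      exact (card_biUnion_lt_iff_forall_of_isRegular hκ ih).2 fun y _ => hf x y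
  -- Any two points lie in a common stage, so `ω` stages suffice; the union is small as `κ` is
  -- regular and uncountable.
  refine ⟨⋃ n : ULift.{u} ℕ, s n.down, ?_, ?_, ?_⟩
  · exact Set.subset_iUnion (fun n : ULift.{u} ℕ => s n.down) ⟨0⟩
  · exact (card_iUnion_lt_iff_forall_of_isRegular hκ (by simpa using hκ')).2 fun n => hcard _
  · intro x hx y hy z hz
    obtain ⟨m, hm⟩ := Set.mem_iUnion.1 hx
    obtain ⟨n, hn⟩ := Set.mem_iUnion.1 hy
    refine Set.mem_iUnion.2 ⟨⟨max m.down n.down + 1⟩, ?_⟩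
    rw [hs]
    exact Or.inr (Set.mem_biUnion (hmono (le_max_left _ _) hm)
      (Set.mem_biUnion (hmono (le_max_right _ _) hn) hz))

/-! ### Finite supports in the interval algebra -/

section Support

variable {C : Type u} [LinearOrder C]

/-- Membership in `b` depends only on the position relative to the points of `N`. -/
def IsCutSupport (N : Finset C) (b : Set C) : Prop :=
  ∀ x y, (∀ n ∈ N, n ≤ x ↔ n ≤ y) → (x ∈ b ↔ y ∈ b)

theorem exists_isCutSupport {b : Set C} (hb : b ∈ intervalAlgebra C) :
    ∃ N : Finset C, IsCutSupport N b := by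
  classical
  induction hb using BooleanSubalgebra.closure_bot_sup_induction with
  | mem b hb =>
    obtain ⟨a, rfl⟩ := hb
    exact ⟨{a}, fun x y h => h a (by simp)⟩
  | bot => exact ⟨∅, fun x y _ => Iff.rfl⟩
  | sup b _ b' _ ih ih' =>
    obtain ⟨N, hN⟩ := ih
    obtain ⟨N', hN'⟩ := ih'
    exact ⟨N ∪ N', fun x y h => or_congr
      (hN x y fun n hn => h n (Finset.mem_union_left _ hn))
      (hN' x y fun n hn => h n (Finset.mem_union_right _ hn))⟩
  | compl b _ ih =>
    obtain ⟨N, hN⟩ := ih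
    exact ⟨N, fun x y h => not_congr (hN x y h)⟩

theorem Ico_mem_intervalAlgebra (u v : C) : Set.Ico u v ∈ intervalAlgebra C := by
  have h (a : C) : Set.Ici a ∈ intervalAlgebra C :=
    BooleanSubalgebra.subset_closure (Set.mem_range_self a)
  have : Set.Ico u v = Set.Ici u \ Set.Ici v := by ext; simp
  rw [this]
  exact BooleanSubalgebra.sdiff_mem (h u) (h v)

theorem exists_Ico_subset [NoMaxOrder C] {b : Set C} (hb : b ∈ intervalAlgebra C) {x : C}
    (hx : x ∈ b) : ∃ y, x < y ∧ Set.Ico x y ⊆ b := by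
  obtain ⟨N, hN⟩ := exists_isCutSupport hb
  obtain ⟨z, hz⟩ := exists_gt x
  -- No support point lies strictly between `x` and `y`; `z` serves if none lies above `x`.
  obtain ⟨y, hxy, hy⟩ : ∃ y, x < y ∧ ∀ n ∈ N, x < n → y ≤ n := by
    clear hN
    classical
    induction N using Finset.induction_on with
    | empty => exact ⟨z, hz, by simp⟩
    | insert n N _ ih =>
      obtain ⟨y, hxy, hy⟩ := ih
      by_cases hn : x < n
      · exact ⟨min y n, lt_min hxy hn, by grind⟩
      · exact ⟨y, hxy, by grind⟩
  refine ⟨y, hxy, fun w hw => (hN x w fun n hn => ⟨fun h => h.trans hw.1, fun h => ?_⟩).1 hx⟩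
  by_contra! h'
  exact (hy n hn h').not_gt (h.trans_lt hw.2)

/-- A nonempty set `L` without greatest element has an element above all those points of a finite
set that are not strict upper bounds of `L`. -/
theorem exists_mem_forall_lt_or_lt {L : Set C} (hne : L.Nonempty)
    (hL : ∀ l ∈ L, ∃ l' ∈ L, l < l') (N : Finset C) :
    ∃ l ∈ L, ∀ n ∈ N, n < l ∨ ∀ l' ∈ L, l' < n := by
  classical
  induction N using Finset.induction_on with
  | empty => exact ⟨hne.some, hne.some_mem, by simp⟩
  | insert n N _ ih =>
    obtain ⟨l, hl, h⟩ := ih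
    by_cases hn : ∀ l' ∈ L, l' < n
    · exact ⟨l, hl, by grind⟩
    · push Not at hn
      obtain ⟨l₁, hl₁, hn⟩ := hn
      obtain ⟨l₂, hl₂, hlt⟩ := hL _ hl₁
      rcases le_total l l₂ with hle | hle
      · exact ⟨l₂, hl₂, by grind⟩
      · exact ⟨l, hl, by grind⟩

/-- A nonempty set `R` without least element has an element below all those points of a finite
set that are not strict lower bounds of `R`. -/
theorem exists_mem_forall_gt_or_gt {R : Set C} (hne : R.Nonempty)
    (hR : ∀ r ∈ R, ∃ r' ∈ R, r' < r) (N : Finset C) :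
    ∃ r ∈ R, ∀ n ∈ N, r < n ∨ ∀ r' ∈ R, n < r' :=
  exists_mem_forall_lt_or_lt (C := Cᵒᵈ) hne hR N

end Support

/-! ### The Stone topology and point ultrafilters -/

namespace Ult

variable {B : Type*} [BooleanAlgebra B]

theorem exists_basic_subset {U : Set (Ult B)} (hU : IsOpen U) {p : Ult B} (hp : p ∈ U) :
    ∃ a ∈ p.elems, {q : Ult B | a ∈ q.elems} ⊆ U := by
  induction hU with
  | basic s hs =>
    obtain ⟨a, rfl⟩ := hs
    exact ⟨a, hp, subset_rfl⟩
  | univ => exact ⟨⊤, Order.PFilter.top_mem, Set.subset_univ _⟩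
  | inter s t _ _ ihs iht =>
    obtain ⟨a, ha, has⟩ := ihs hp.1
    obtain ⟨b, hb, hbt⟩ := iht hp.2
    exact ⟨a ⊓ b, Order.PFilter.inf_mem ha hb, fun q hq =>
      ⟨has (Order.PFilter.mem_of_le inf_le_left hq),
        hbt (Order.PFilter.mem_of_le inf_le_right hq)⟩⟩
  | sUnion S _ ih =>
    obtain ⟨s, hs, hps⟩ := hp
    obtain ⟨a, ha, has⟩ := ih s hs hps
    exact ⟨a, ha, has.trans (Set.subset_sUnion_of_mem hs)⟩

theorem isOpen_basic (a : B) : IsOpen {p : Ult B | a ∈ p.elems} :=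
  TopologicalSpace.isOpen_generateFrom_of_mem ⟨a, rfl⟩

/-- The ultrafilter of a set algebra determined by a point. -/
def ofPoint {X : Type*} (B : BooleanSubalgebra (Set X)) (x : X) : Ult B where
  toPFilter := Order.IsPFilter.toPFilter (F := {b : B | x ∈ b.1}) <|
    Order.IsPFilter.of_def ⟨⊤, Set.mem_univ x⟩
      (fun a ha b hb => ⟨a ⊓ b, ⟨ha, hb⟩, inf_le_left, inf_le_right⟩)
      (fun hab ha => hab ha)
  bot_notMem := fun h => h
  mem_or_compl_mem := fun a => em (x ∈ a.1)

theorem mem_elems_ofPoint {X : Type*} {B : BooleanSubalgebra (Set X)} {x : X} {b : B} :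
    b ∈ (ofPoint B x).elems ↔ x ∈ b.1 := Iff.rfl

end Ult

/-! ### Filling the gaps of a closed set -/

/-- Suppose that `A` contains `c` and `d`, that the part of `A` below (above) any point outside `A`
has no greatest (least) element, and that the generators containing an interval between two points
of `A ∩ [c, d]` are supported by `A`. Then `A` contains every point of `[c, d)`. -/
theorem mem_of_generators_supported {C : Type u} [LinearOrder C] {G : Set (intervalAlgebra C)}
    (hG : IsGenerating G) {N : intervalAlgebra C → Finset C} (hN : ∀ g, IsCutSupport (N g) g.1)
    {A : Set C} {c d x : C} (hc : c ∈ A) (hd : d ∈ A)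
    (hL : ∀ a ∈ A, a < x → ∃ a' ∈ A, a < a' ∧ a' ≤ x)
    (hR : ∀ a ∈ A, x < a → ∃ a' ∈ A, a' < a ∧ x ≤ a')
    (hA : ∀ u ∈ A, ∀ v ∈ A, c ≤ u → u < v → v ≤ d → ∀ g ∈ G, Set.Ico u v ⊆ g.1 →
      ∀ n ∈ N g, n ∈ A) (hcx : c ≤ x) (hxd : x < d) : x ∈ A := by
  by_contra hx
  have hne {a : C} (ha : a ∈ A) : a ≠ x := fun h => hx (h ▸ ha)
  let L : Set C := {a ∈ A | c ≤ a ∧ a < x}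
  let R : Set C := {a ∈ A | a ≤ d ∧ x < a}
  have hLne : L.Nonempty := ⟨c, hc, le_rfl, hcx.lt_of_ne (hne hc)⟩
  have hRne : R.Nonempty := ⟨d, hd, le_rfl, hxd⟩
  have hL' : ∀ l ∈ L, ∃ l' ∈ L, l < l' := fun l hl => by
    obtain ⟨a, ha, h₁, h₂⟩ := hL l hl.1 hl.2.2
    exact ⟨a, ⟨ha, hl.2.1.trans h₁.le, h₂.lt_of_ne (hne ha)⟩, h₁⟩
  have hR' : ∀ r ∈ R, ∃ r' ∈ R, r' < r := fun r hr => by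
    obtain ⟨a, ha, h₁, h₂⟩ := hR r hr.1 hr.2.2
    exact ⟨a, ⟨ha, h₁.le.trans hr.2.1, h₂.lt_of_ne (hne ha).symm⟩, h₁⟩
  -- Being constant on `A` near the gap passes to Boolean combinations, so only generators need an
  -- argument.
  have key (b : intervalAlgebra C) : ∃ l ∈ L, ∃ r ∈ R, ∀ y ∈ A, ∀ z ∈ A,
      l ≤ y → y ≤ r → l ≤ z → z ≤ r → (y ∈ b.1 ↔ z ∈ b.1) := by
    have hb : b ∈ BooleanSubalgebra.closure G := by
      rw [show BooleanSubalgebra.closure G = ⊤ from hG]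
      trivial
    induction hb using BooleanSubalgebra.closure_bot_sup_induction with
    | mem g hg =>
      obtain ⟨l, hl, hlN⟩ := exists_mem_forall_lt_or_lt hLne hL' (N g)
      obtain ⟨r, hr, hrN⟩ := exists_mem_forall_gt_or_gt hRne hR' (N g)
      refine ⟨l, hl, r, hr, ?_⟩
      -- If the support lies in `A`, it misses `x`, so all of it is below `l` or above `r`.
      by_cases hgA : ∀ n ∈ N g, n ∈ A
      · intro y hy z hz hly hyr hlz hzr
        refine hN g y z fun n hn => ?_
        have h₁ := hlN n hn
        have h₂ := hrN n hn
        rcases lt_or_gt_of_ne (hne (hgA n hn)) with h | h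
        · have : n < l := h₁.resolve_right fun h' => (h' l hl).not_ge <| by
            by_contra! h''
            exact lt_irrefl _ (h' n ⟨hgA n hn, hl.2.1.trans h''.le, h⟩)
          exact iff_of_true (this.le.trans hly) (this.le.trans hlz)
        · have : r < n := h₂.resolve_right fun h' => (h' r hr).not_ge <| by
            by_contra! h''
            exact lt_irrefl _ (h' n ⟨hgA n hn, h''.le.trans hr.2.1, h⟩)
          exact iff_of_false (hyr.trans_lt this).not_ge (hzr.trans_lt this).not_ge
      -- If `g` met `A` in `[l, r]`, it would include an interval between two points of `A`, as no
      -- support point separates them, and `hA` would put its support in `A`.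
      · have hout : ∀ y ∈ A, l ≤ y → y ≤ r → y ∉ g.1 := by
          intro y hy hly hyr hyg
          apply hgA
          rcases lt_or_gt_of_ne (hne hy) with h | h
          · have hyL : y ∈ L := ⟨hy, hl.2.1.trans hly, h⟩
            obtain ⟨l', hl', hyl'⟩ := hL' y hyL
            refine hA y hy l' hl'.1 hyL.2.1 hyl' (hl'.2.2.trans hxd).le g hg fun w hw => ?_
            refine (hN g y w fun n hn => ?_).1 hyg
            rcases hlN n hn with h' | h'
            · exact iff_of_true (h'.le.trans hly) (h'.le.trans (hly.trans hw.1))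
            · exact iff_of_false (h' y hyL).not_ge (hw.2.trans (h' l' hl')).not_ge
          · have hyR : y ∈ R := ⟨hy, hyr.trans hr.2.1, h⟩
            obtain ⟨r', hr', hyr'⟩ := hR' y hyR
            refine hA r' hr'.1 y hy (hcx.trans hr'.2.2.le) hyr' hyR.2.1 g hg fun w hw => ?_
            refine (hN g y w fun n hn => ?_).1 hyg
            rcases hrN n hn with h' | h'
            · exact iff_of_false (hyr.trans_lt h').not_ge ((hw.2.le.trans hyr).trans_lt h').not_ge
            · exact iff_of_true (h' y hyR).le ((h' r' hr').le.trans hw.1)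
        intro y hy z hz hly hyr hlz hzr
        exact iff_of_false (hout y hy hly hyr) (hout z hz hlz hzr)
    | bot =>
      exact ⟨hLne.some, hLne.some_mem, hRne.some, hRne.some_mem, fun _ _ _ _ _ _ _ _ => Iff.rfl⟩
    | sup b _ b' _ ih ih' =>
      obtain ⟨l, hl, r, hr, h⟩ := ih
      obtain ⟨l', hl', r', hr', h'⟩ := ih'
      refine ⟨max l l', ?_, min r r', ?_, fun y hy z hz hly hyr hlz hzr => or_congr ?_ ?_⟩
      · rcases max_choice l l' with e | e <;> rw [e] <;> assumption
      · rcases min_choice r r' with e | e <;> rw [e] <;> assumption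
      · exact h y hy z hz (le_of_max_le_left hly) (le_min_iff.1 hyr).1
          (le_of_max_le_left hlz) (le_min_iff.1 hzr).1
      · exact h' y hy z hz (le_of_max_le_right hly) (le_min_iff.1 hyr).2
          (le_of_max_le_right hlz) (le_min_iff.1 hzr).2
    | compl b _ ih =>
      obtain ⟨l, hl, r, hr, h⟩ := ih
      exact ⟨l, hl, r, hr, fun y hy z hz h₁ h₂ h₃ h₄ => not_congr (h y hy z hz h₁ h₂ h₃ h₄)⟩
  obtain ⟨l, hl, r, hr, h⟩ :=
    key ⟨Set.Ici x, BooleanSubalgebra.subset_closure (Set.mem_range_self x)⟩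
  have hlr : l < r := hl.2.2.trans hr.2.2
  exact hl.2.2.not_ge ((h l hl.1 r hr.1 le_rfl hlr.le hlr.le le_rfl).2 hr.2.2.le)

theorem mainTheorem10 {C : Type*} [LinearOrder C] [NoMaxOrder C] (κ : Cardinal)
    (hκ : κ.IsRegular) (hκ' : ℵ₀ < κ) (hC : #C = κ)
    (hI : ∀ I : Set C, I.OrdConnected → I.Nontrivial → #I = κ)
    (hinc : ∀ A : Set C, IsEmpty (A ≃o κ.ord.ToType))
    (hdec : ∀ A : Set C, IsEmpty (A ≃o (κ.ord.ToType)ᵒᵈ))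
    (G : Set (intervalAlgebra C)) (hG : IsGenerating G) :
    IsNowhereDense {p : Ult (intervalAlgebra C) | #(G ∩ p.elems : Set (intervalAlgebra C)) < κ} := by
  by_contra hS
  obtain ⟨p, hp⟩ := Set.nonempty_iff_ne_empty.2 hS
  obtain ⟨a, ha, haS⟩ := Ult.exists_basic_subset isOpen_interior hp
  have ha_ne : (a.1 : Set C).Nonempty := by
    by_contra! h
    exact p.bot_notMem ((Subtype.ext h : a = ⊥) ▸ ha)
  obtain ⟨c, hca⟩ := ha_ne
  obtain ⟨d, hcd, hsub⟩ := exists_Ico_subset a.2 hca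
  -- For other pairs any member of `S` will do, so that the closure operation is total and small
  -- everywhere.
  have hdense : ∀ u v : C, ∃ p : Ult (intervalAlgebra C),
      #(G ∩ p.elems : Set (intervalAlgebra C)) < κ ∧
        (c ≤ u → u < v → v ≤ d → ⟨Set.Ico u v, Ico_mem_intervalAlgebra u v⟩ ∈ p.elems) := by
    intro u v
    by_cases h : c ≤ u ∧ u < v ∧ v ≤ d
    · have hu : Ult.ofPoint (intervalAlgebra C) u ∈ closure {p : Ult (intervalAlgebra C) |
          #(G ∩ p.elems : Set (intervalAlgebra C)) < κ} :=
        interior_subset (haS (Ult.mem_elems_ofPoint.2 (hsub ⟨h.1, h.2.1.trans_le h.2.2⟩)))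
      obtain ⟨q, hq, hqS⟩ := mem_closure_iff.1 hu _
        (Ult.isOpen_basic ⟨Set.Ico u v, Ico_mem_intervalAlgebra u v⟩)
        (Ult.mem_elems_ofPoint.2 (Set.left_mem_Ico.2 h.2.1))
      exact ⟨q, hqS, fun _ _ _ => hq⟩
    · obtain ⟨q, -, hqS⟩ := mem_closure_iff.1 (interior_subset hp) _ isOpen_univ trivial
      exact ⟨q, hqS, fun h₁ h₂ h₃ => (h ⟨h₁, h₂, h₃⟩).elim⟩
  choose q hqS hq using hdense
  choose N hN using fun g : intervalAlgebra C => exists_isCutSupport g.2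
  choose E hEcard hElt hE using exists_small_cofinal_Iio κ hinc
  choose F hFcard hFlt hF using exists_small_coinitial_Ioi κ hdec
  obtain ⟨A, hA₀, hAcard, hA⟩ := exists_small_closed hκ hκ'
    (fun u v => (E u ∪ F u) ∪ ⋃ g ∈ G ∩ (q u v).elems, (N g : Set C))
    (fun u v => by
      refine (mk_union_le _ _).trans_lt (add_lt_of_lt hκ.aleph0_le ?_ ?_)
      · exact (mk_union_le _ _).trans_lt (add_lt_of_lt hκ.aleph0_le (hEcard u) (hFcard u))
      · exact (card_biUnion_lt_iff_forall_of_isRegular hκ (hqS u v)).2 fun g _ =>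
          (N g).finite_toSet.lt_aleph0.trans hκ')
    {c, d} ((Set.toFinite _).lt_aleph0.trans hκ')
  have hcA : c ∈ A := hA₀ (by simp)
  have hdA : d ∈ A := hA₀ (by simp)
  have hcard : #(Set.Icc c d) = κ :=
    hI _ Set.ordConnected_Icc ⟨c, ⟨le_rfl, hcd.le⟩, d, ⟨hcd.le, le_rfl⟩, hcd.ne⟩
  have hsubA : Set.Icc c d ⊆ A := by
    intro x hx
    rcases hx.2.eq_or_lt with rfl | hxd
    · exact hdA
    refine mem_of_generators_supported hG hN hcA hdA ?_ ?_ ?_ hx.1 hxd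
    -- Points of `A` above `a` come from the coinitial set `F a`, not from a cofinal set at `x`,
    -- which is not known to be in `A`.
    · intro a ha hax
      obtain ⟨y, hy, hyx⟩ := hF a x hax
      exact ⟨y, hA a ha a ha (Or.inl (Or.inr hy)), hFlt a y hy, hyx⟩
    · intro a ha hax
      obtain ⟨y, hy, hyx⟩ := hE a x hax
      exact ⟨y, hA a ha a ha (Or.inl (Or.inl hy)), hElt a y hy, hyx⟩
    · intro u hu v hv hcu huv hvd g hg hsubg n hn
      exact hA u hu v hv (Or.inr (Set.mem_biUnion
        ⟨hg, Order.PFilter.mem_of_le (show _ ≤ g from hsubg) (hq u v hcu huv hvd)⟩ hn))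
  exact ((mk_le_mk_of_subset hsubA).trans_lt hAcard).ne hcard
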